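/- **Setting.** Let $N\ge K+2$, $K\ge 2$, $\varepsilon=1/N$, and let $\mathcal U=\{u\in\mathbb R^{2N+1}: u_{-N}=u_N=0\}$ (indices $-N,\dots,N$). Put $v'_\ell=\varepsilon^{-1}(v_\ell-v_{\ell-1})$, $\langle v,w\rangle=\varepsilon\sum_{\ell=-N+1}^N v_\ell w_\ell$ and $\|v\|_{\mathcal U^{1,2}}=\big(\varepsilon\sum_{\ell=-N+1}^N|v'_\ell|^2\big)^{1/2}$; for a linear map $A:\mathcal U\to\mathcal U$ let $\|A\|_{\mathcal U^{1,2}}=\sup_{v\ne0}\|Av\|_{\mathcal U^{1,2}}/\|v\|_{\mathcal U^{1,2}}$. Let $\phi''_F>0$ and $\phi''_{2F}$ be real numbers (the second derivatives of the pair potential at $F$ and $2F$) and $A_F=\phi''_F+4\phi''_{2F}$. Write $(\Delta_1v)_j=\varepsilon^{-2}(-v_{j+1}+2v_j-v_{j-1})$ and $(\Delta_2v)_j=\varepsilon^{-2}(-v_{j+2}+2v_j-v_{j-2})$. For $|j|\le N-1$, the force-based operator is $$(L^{\rm qcf}v)_j=\begin{cases}\phi''_F(\Delta_1v)_j+\phi''_{2F}(\Delta_2v)_j,&|j|\le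 K,\\ A_F(\Delta_1v)_j,&|j|>K,\end{cases}$$ and the energy-based operator is, for $0\le j\le N-1$, $$(L^{\rm qce}v)_j=\phi''_F(\Delta_1v)_j+\phi''_{2F}\begin{cases}(\Delta_2v)_j,&j\le K-2,\\ (\Delta_2v)_j+\frac{v_{j+2}-v_j}{2\varepsilon^2},&j=K-1,\\ (\Delta_2v)_j-\frac{2(v_{j+1}-v_j)}{\varepsilon^2}+\frac{v_{j+2}-v_j}{2\varepsilon^2},&j=K,\\ 4(\Delta_1v)_j-\frac{2(v_j-v_{j-1})}{\varepsilon^2}+\frac{v_j-v_{j-2}}{2\varepsilon^2},&j=K+1,\\ 4(\Delta_1v)_j+\frac{v_j-v_{j-2}}{2\varepsilon^2},&j=K+2,\\ 4(\Delta_1v)_j,&j\ge K+3,\end{cases}$$ the rows $j<0$ being obtained by the reflection $j\mapsto-j$. Both are regarded as operators on $\mathcal U$ (value $0$ at $j=\pm N$). Let $\lambda_K$ be the number, depending only on $K$, with $$\inf_{N\ge K+2}\ \inf_{u\in\mathcal U,\ \|u\|_{\mathcal U^{1,2}}=1}\langle L^{\rm qce}u,u\rangle=A_F+\lambda_K\phi''_{2F}\qquad\text{whenever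 }\phi''_{2F}\le0;$$ equivalently, $-\lambda_K$ is this infimum for $\phi''_F=4$, $\phi''_{2F}=-1$. When $L^{\rm qce}$ is invertible, the iteration operator of the ghost force correction (GFC) is $G_{\rm qce}=I-(L^{\rm qce})^{-1}L^{\rm qcf}$. **Proposition.** Let $\phi''_F>0$ and $\phi''_{2F}\neq0$. There are $C>0$ and $N_0\in\mathbb N$, depending only on $\phi''_F$ and $\phi''_{2F}$, such that for all $N\ge N_0$ and all $K$ with $2\le K\le N/2$ and $A_F+\lambda_K\phi''_{2F}>0$, the operator $L^{\rm qce}$ is invertible and $$C^{-1}N^{1/2}\ \le\ \|G_{\rm qce}\|_{\mathcal U^{1,2}}\ \le\ C\,N^{1/2},\qquad \|G_{\rm qce}\|_{\mathcal U^{1,2}}>1 .$$ In particular, the GFC iteration is not a contraction in $\mathcal U^{1,2}$ for large $N$, and hence not a uniform contraction, however far the strain is from the critical one. -/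

import Mathlib

noncomputable section

namespace QC

/-- The displacement space for the chain of `2N+1` atoms `-N, …, N` with both ends clamped:
`u_{-N} = u_N = 0`.  A displacement is stored as a function on `ℤ`, extended by zero. -/
def Disp (N : ℕ) : Submodule ℝ (ℤ → ℝ) where
  carrier := {u | ∀ j : ℤ, (N : ℤ) ≤ |j| → u j = 0}
  zero_mem' := fun _ _ => rfl
  add_mem' := by
    intro u v hu hv j hj
    simp [hu j hj, hv j hj]
  smul_mem' := by
    intro c u hu j hj
    simp [hu j hj]

/-- The lattice spacing `ε = 1/N`. -/
def eps (N : ℕ) : ℝ := 1 / (N : ℝ)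

/-- The backward difference quotient `v'_ℓ = (v_ℓ - v_{ℓ-1}) / ε`. -/
def strain (N : ℕ) (v : ℤ → ℝ) (l : ℤ) : ℝ := (v l - v (l - 1)) / eps N

/-- The inner product `⟨v, w⟩ = ε ∑_{ℓ=-N+1}^{N} v_ℓ w_ℓ`. -/
def ip (N : ℕ) (v w : ℤ → ℝ) : ℝ :=
  eps N * ∑ l ∈ Finset.Icc (-(N : ℤ) + 1) (N : ℤ), v l * w l

/-- The discrete Sobolev norm `‖v‖_{U^{1,2}} = ‖v'‖_{ℓ²_ε}`. -/
def normU12 (N : ℕ) (v : ℤ → ℝ) : ℝ :=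
  Real.sqrt (eps N * ∑ l ∈ Finset.Icc (-(N : ℤ) + 1) (N : ℤ), |strain N v l| ^ 2)

/-- The operator norm on `U^{1,2}`: the supremum of `‖A v‖ / ‖v‖` over nonzero displacements. -/
def opNormU12 (N : ℕ) (A : Module.End ℝ (Disp N)) : ℝ :=
  sSup {r : ℝ | ∃ v : Disp N, v ≠ 0 ∧ r = normU12 N (A v) / normU12 N v}

/-- Nearest-neighbour second difference `(-v_{j+1} + 2 v_j - v_{j-1}) / ε²`. -/
def lap1 (N : ℕ) (v : ℤ → ℝ) (j : ℤ) : ℝ :=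
  (-v (j + 1) + 2 * v j - v (j - 1)) / eps N ^ 2

/-- Next-nearest-neighbour second difference `(-v_{j+2} + 2 v_j - v_{j-2}) / ε²`. -/
def lap2 (N : ℕ) (v : ℤ → ℝ) (j : ℤ) : ℝ :=
  (-v (j + 2) + 2 * v j - v (j - 2)) / eps N ^ 2

/-- The linearized atomistic operator, with `a = φ''_F` and `b = φ''_{2F}`. -/
def atRow (N : ℕ) (a b : ℝ) (v : ℤ → ℝ) (j : ℤ) : ℝ :=
  a * lap1 N v j + b * lap2 N v j

/-- The linearized local quasicontinuum operator `A_F L`, where `A_F = φ''_F + 4 φ''_{2F}`. -/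
def qclRow (N : ℕ) (a b : ℝ) (v : ℤ → ℝ) (j : ℤ) : ℝ :=
  (a + 4 * b) * lap1 N v j

/-- The linearized force-based operator: atomistic rows for `|j| ≤ K`, local rows elsewhere. -/
def qcfRow (N K : ℕ) (a b : ℝ) (v : ℤ → ℝ) (j : ℤ) : ℝ :=
  if |j| ≤ (K : ℤ) then atRow N a b v j else qclRow N a b v j

/-- The rows `j ≥ 0` of the linearized energy-based quasicontinuum operator. -/
def qceHalfRow (N K : ℕ) (a b : ℝ) (v : ℤ → ℝ) (j : ℤ) : ℝ :=
  a * lap1 N v j + b *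
    (if j ≤ (K : ℤ) - 2 then lap2 N v j
    else if j = (K : ℤ) - 1 then
      lap2 N v j + 1 / eps N * ((v (j + 2) - v j) / (2 * eps N))
    else if j = (K : ℤ) then
      lap2 N v j - 2 / eps N * ((v (j + 1) - v j) / eps N)
        + 1 / eps N * ((v (j + 2) - v j) / (2 * eps N))
    else if j = (K : ℤ) + 1 then
      4 * lap1 N v j - 2 / eps N * ((v j - v (j - 1)) / eps N)
        + 1 / eps N * ((v j - v (j - 2)) / (2 * eps N))
    else if j = (K : ℤ) + 2 then
      4 * lap1 N v j + 1 / eps N * ((v j - v (j - 2)) / (2 * eps N))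
    else 4 * lap1 N v j)

/-- All rows of the linearized energy-based operator; the rows `j < 0` are the mirror images of
the rows `j > 0` under the reflection `j ↦ -j`. -/
def qceRow (N K : ℕ) (a b : ℝ) (v : ℤ → ℝ) (j : ℤ) : ℝ :=
  if 0 ≤ j then qceHalfRow N K a b v j
  else qceHalfRow N K a b (fun i => v (-i)) (-j)

theorem qceHalfRow_add (N K : ℕ) (a b : ℝ) (v w : ℤ → ℝ) (j : ℤ) :
    qceHalfRow N K a b (v + w) j = qceHalfRow N K a b v j + qceHalfRow N K a b w j := by
  simp only [qceHalfRow, lap1, lap2, Pi.add_apply]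
  split_ifs <;> ring

theorem qceHalfRow_smul (N K : ℕ) (a b c : ℝ) (v : ℤ → ℝ) (j : ℤ) :
    qceHalfRow N K a b (c • v) j = c * qceHalfRow N K a b v j := by
  simp only [qceHalfRow, lap1, lap2, Pi.smul_apply, smul_eq_mul]
  split_ifs <;> ring

theorem qceRow_add (N K : ℕ) (a b : ℝ) (v w : ℤ → ℝ) (j : ℤ) :
    qceRow N K a b (v + w) j = qceRow N K a b v j + qceRow N K a b w j := by
  unfold qceRow
  split_ifs
  · exact qceHalfRow_add N K a b v w j
  · exact qceHalfRow_add N K a b (fun i => v (-i)) (fun i => w (-i)) (-j)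

theorem qceRow_smul (N K : ℕ) (a b c : ℝ) (v : ℤ → ℝ) (j : ℤ) :
    qceRow N K a b (c • v) j = c * qceRow N K a b v j := by
  unfold qceRow
  split_ifs
  · exact qceHalfRow_smul N K a b c v j
  · exact qceHalfRow_smul N K a b c (fun i => v (-i)) (-j)

/-- The force-based operator on the displacement space: its rows at the free atoms `|j| < N`,
and the value zero at the clamped atoms. -/
def Lqcf (N K : ℕ) (a b : ℝ) : Module.End ℝ (Disp N) where
  toFun u := ⟨fun j => if |j| < (N : ℤ) then qcfRow N K a b (u : ℤ → ℝ) j else 0,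
    fun _ hj => if_neg (not_lt.mpr hj)⟩
  map_add' := by
    intro u v
    ext j
    simp only [Submodule.coe_add, Pi.add_apply, qcfRow, atRow, qclRow, lap1, lap2]
    split_ifs <;> ring
  map_smul' := by
    intro c u
    ext j
    simp only [Submodule.coe_smul, Pi.smul_apply, smul_eq_mul, RingHom.id_apply, qcfRow, atRow,
      qclRow, lap1, lap2]
    split_ifs <;> ring

/-- The energy-based operator on the displacement space: its rows at the free atoms `|j| < N`,
and the value zero at the clamped atoms. -/
def Lqce (N K : ℕ) (a b : ℝ) : Module.End ℝ (Disp N) where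
  toFun u := ⟨fun j => if |j| < (N : ℤ) then qceRow N K a b (u : ℤ → ℝ) j else 0,
    fun _ hj => if_neg (not_lt.mpr hj)⟩
  map_add' := by
    intro u v
    ext j
    change (if |j| < (N : ℤ) then qceRow N K a b ((u : ℤ → ℝ) + (v : ℤ → ℝ)) j else 0) =
      (if |j| < (N : ℤ) then qceRow N K a b (u : ℤ → ℝ) j else 0) +
      (if |j| < (N : ℤ) then qceRow N K a b (v : ℤ → ℝ) j else 0)
    rw [qceRow_add]
    split_ifs <;> ring
  map_smul' := by
    intro c u
    ext j
    change (if |j| < (N : ℤ) then qceRow N K a b (c • (u : ℤ → ℝ)) j else 0) =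
      c * (if |j| < (N : ℤ) then qceRow N K a b (u : ℤ → ℝ) j else 0)
    rw [qceRow_smul]
    split_ifs <;> ring

/-- The iteration matrix `G = I - (L^{qce})⁻¹ L^{qcf}` of the ghost force correction. -/
def Gqce (N K : ℕ) (a b : ℝ) : Module.End ℝ (Disp N) :=
  1 - Ring.inverse (Lqce N K a b) * Lqcf N K a b

/-- The stability constant of the energy-based operator with atomistic half-width `K`:
the infimum of `⟨L^{qce} u, u⟩` over `‖u'‖ = 1` and over all admissible chain lengths. -/
def qceStab (K : ℕ) (a b : ℝ) : ℝ :=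
  sInf {r : ℝ | ∃ N : ℕ, K + 2 ≤ N ∧ ∃ u : Disp N,
    normU12 N u = 1 ∧ r = ip N (Lqce N K a b u) u}

/-- The number `λ_K` such that the stability constant is `A_F + λ_K φ''_{2F}` for all
`φ''_{2F} ≤ 0`, where `A_F = φ''_F + 4 φ''_{2F}`.  The form `⟨L^{qce} u, u⟩` is
`A_F ‖u'‖² + φ''_{2F} q(u)` with `q` independent of the coefficients, so `λ_K` can be read off at
`A_F = 0`, `φ''_{2F} = -1`, that is, at `φ''_F = 4`, `φ''_{2F} = -1`. -/
def lamK (K : ℕ) : ℝ := -qceStab K 4 (-1)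

end QC

end

/-!
The residual `L^{qce} - L^{qcf}` lives on the four atoms of each interface, where `ε` times its size
is that of the strains there.  Strains are bounded pointwise by `√N` times the `U^{1,2}` norm and
displacements by a constant times it, so the upper bound follows once `L^{qce}` is coercive
uniformly in `N` and `K`.

For `φ''_{2F} ≥ 0` the form is coercive with constant `φ''_F`.  For `φ''_{2F} < 0` it is coercive
with constant `A_F + λ_K φ''_{2F}`, and `λ_K` is antitone in `K`, so the constant of the smallest
admissible `K` serves for all of them.  For the monotonicity, the quadratic form in the strains is
split into two mirror-image half-chain forms plus a jump across the centre.  The constraint that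
strains have mean zero costs nothing, since a long tail of small constant strain meets it, and
without this constraint dropping the first strain compares the half-chain forms of `K + 1` and `K`.

For the lower bound, test with a plateau that is constant on the atomistic region and both
interfaces.  Against it `L^{qce}` acts as the local operator, whereas the residual of a hat at the
interface exerts a net force of order `N`.  The hat has norm `√(2N)`, which leaves a factor `√N`.
-/

noncomputable section

namespace QC

open Finset

variable {N K : ℕ} {a b : ℝ}

/-- The bonds `-N + 1, …, N` of the chain; bond `l` joins the atoms `l - 1` and `l`. -/
abbrev bonds (N : ℕ) : Finset ℤ := Icc (-(N : ℤ) + 1) N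

theorem sum_Icc_sub_pred {G : Type*} [AddCommGroup G] (f : ℤ → G) {m n : ℤ} (h : m ≤ n) :
    ∑ l ∈ Icc (m + 1) n, (f l - f (l - 1)) = f n - f m := by
  induction n, h using Int.leInduction with
  | base => simp
  | succ n h ih =>
    rw [← insert_Icc_right_eq_Icc_add_one (by omega), sum_insert (by simp), ih]
    simp

theorem sum_Icc_sub_pred_mul {R : Type*} [CommRing R] (s e : ℤ → R) {m n : ℤ} (h : m ≤ n) :
    ∑ l ∈ Icc (m + 1) n, (s l - s (l - 1)) * e l =
      s n * e (n + 1) - s m * e (m + 1) - ∑ l ∈ Icc (m + 1) n, s l * (e (l + 1) - e l) := by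
  rw [← sum_Icc_sub_pred (fun l => s l * e (l + 1)) h, ← sum_sub_distrib]
  refine sum_congr rfl fun l _ => ?_
  rw [sub_add_cancel]
  ring

theorem sum_bonds_eq_sum_range {M : Type*} [AddCommMonoid M] (N : ℕ) (f : ℤ → M) :
    ∑ l ∈ bonds N, f l = ∑ i ∈ range N, f (i + 1) + ∑ i ∈ range N, f (-i) := by
  induction N with
  | zero => simp [bonds]
  | succ n ih =>
    have hbonds : bonds (n + 1) = insert (n + 1 : ℤ) (insert (-n : ℤ) (bonds n)) := by
      ext l
      simp only [mem_insert, mem_Icc]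
      omega
    rw [hbonds, sum_insert (by simp; omega), sum_insert (by simp), ih, sum_range_succ,
      sum_range_succ]
    abel

theorem eps_nonneg : 0 ≤ eps N := one_div_nonneg.mpr N.cast_nonneg

theorem eps_pos (hN : 0 < N) : 0 < eps N := one_div_pos.mpr (Nat.cast_pos.mpr hN)

theorem inv_eps : (eps N)⁻¹ = N := by rw [eps, one_div, inv_inv]

theorem eps_mul_cast (hN : 0 < N) : eps N * N = 1 :=
  one_div_mul_cancel (Nat.cast_ne_zero.mpr hN.ne')

theorem disp_apply_eq_zero (u : Disp N) {j : ℤ} (hj : (N : ℤ) ≤ |j|) : (u : ℤ → ℝ) j = 0 :=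
  u.2 j hj

theorem eps_mul_strain (hN : 0 < N) (v : ℤ → ℝ) (l : ℤ) :
    eps N * strain N v l = v l - v (l - 1) :=
  mul_div_cancel₀ _ (eps_pos hN).ne'

theorem strain_smul (c : ℝ) (v : ℤ → ℝ) (l : ℤ) : strain N (c • v) l = c * strain N v l := by
  simp only [strain, Pi.smul_apply, smul_eq_mul]
  ring

theorem strain_comp_neg (v : ℤ → ℝ) (l : ℤ) :
    strain N (fun i => v (-i)) l = -strain N v (1 - l) := by
  simp only [strain, neg_sub, sub_sub_cancel_left]
  ring

theorem exists_strain_eq (hN : 0 < N) {d : ℤ → ℝ} (hd : ∑ l ∈ bonds N, d l = 0) :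
    ∃ u : Disp N, ∀ l ∈ bonds N, strain N u l = d l := by
  let u (j : ℤ) : ℝ := eps N * ∑ l ∈ Icc (-(N : ℤ) + 1) j, d l
  have hu : ∀ l, -(N : ℤ) + 1 ≤ l → u l - u (l - 1) = eps N * d l := by
    intro l hl
    have hinsert := insert_Icc_right_eq_Icc_add_one (a := -(N : ℤ) + 1) (b := l - 1) (by omega)
    simp only [sub_add_cancel] at hinsert
    simp only [u, ← hinsert]
    rw [sum_insert (by simp)]
    ring
  have hu_left : u (-N) = 0 := by simp [u]
  have hu_right : u N = 0 := by simp only [u, hd, mul_zero]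
  refine ⟨⟨fun j => if |j| < (N : ℤ) then u j else 0, fun j hj => if_neg (not_lt.mpr hj)⟩,
    fun l hl => ?_⟩
  have hclamp : ∀ j : ℤ, |j| ≤ N → (if |j| < (N : ℤ) then u j else 0) = u j := by
    intro j hj
    split_ifs with h
    · rfl
    · rcases abs_choice j with hc | hc
      · rw [show j = N by omega, hu_right]
      · rw [show j = -N by omega, hu_left]
  rw [mem_Icc] at hl
  simp only [strain]
  rw [hclamp l (abs_le.mpr (by omega)), hclamp (l - 1) (abs_le.mpr (by omega)), hu l hl.1,
    mul_div_cancel_left₀ _ (eps_pos hN).ne']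

theorem normU12_nonneg (v : ℤ → ℝ) : 0 ≤ normU12 N v := Real.sqrt_nonneg _

theorem normU12_sq (v : ℤ → ℝ) :
    normU12 N v ^ 2 = eps N * ∑ l ∈ bonds N, strain N v l ^ 2 := by
  rw [normU12, Real.sq_sqrt (mul_nonneg eps_nonneg (sum_nonneg fun _ _ => by positivity))]
  simp only [sq_abs]

theorem normU12_smul (c : ℝ) (v : ℤ → ℝ) : normU12 N (c • v) = |c| * normU12 N v := by
  simp only [normU12, strain_smul, abs_mul, mul_pow, ← mul_sum]
  rw [mul_left_comm, Real.sqrt_mul (by positivity), Real.sqrt_sq (abs_nonneg c)]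

theorem ip_smul_smul (c : ℝ) (v w : ℤ → ℝ) : ip N (c • v) (c • w) = c ^ 2 * ip N v w := by
  simp only [ip, Pi.smul_apply, smul_eq_mul, mul_mul_mul_comm c, ← sq, ← mul_sum]
  ring

theorem abs_sum_strain_mul_strain_le (v w : ℤ → ℝ) :
    |eps N * ∑ l ∈ bonds N, strain N v l * strain N w l| ≤ normU12 N v * normU12 N w := by
  refine abs_le_of_sq_le_sq ?_ (mul_nonneg (normU12_nonneg v) (normU12_nonneg w))
  rw [mul_pow, mul_pow, normU12_sq, normU12_sq, mul_mul_mul_comm, ← sq]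
  exact mul_le_mul_of_nonneg_left (sum_mul_sq_le_sq_mul_sq _ _ _) (sq_nonneg _)

theorem abs_strain_le (u : Disp N) (l : ℤ) : |strain N u l| ≤ √N * normU12 N u := by
  have hbound : 0 ≤ √N * normU12 N u := mul_nonneg (Real.sqrt_nonneg _) (normU12_nonneg _)
  by_cases hl : l ∈ bonds N
  · have hN : 0 < N := by rw [mem_Icc] at hl; omega
    refine abs_le_of_sq_le_sq ?_ hbound
    rw [mul_pow, Real.sq_sqrt N.cast_nonneg, normU12_sq, ← mul_assoc, mul_comm (N : ℝ),
      eps_mul_cast hN, one_mul]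
    exact single_le_sum (f := fun l => strain N u l ^ 2) (fun _ _ => sq_nonneg _) hl
  · rw [mem_Icc] at hl
    rw [strain, disp_apply_eq_zero u (le_abs.mpr (by omega)),
      disp_apply_eq_zero u (le_abs.mpr (by omega))]
    simpa using hbound

theorem disp_apply_eq_sum_strain (u : Disp N) {j : ℤ} (hj : |j| < N) :
    (u : ℤ → ℝ) j = eps N * ∑ l ∈ Icc (-(N : ℤ) + 1) j, strain N u l := by
  rw [abs_lt] at hj
  simp only [mul_sum, eps_mul_strain (show 0 < N by omega)]
  rw [sum_Icc_sub_pred _ (by omega), disp_apply_eq_zero u (j := -N) (by simp), sub_zero]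

theorem abs_disp_apply_le (u : Disp N) (j : ℤ) : |(u : ℤ → ℝ) j| ≤ √2 * normU12 N u := by
  have hbound : 0 ≤ √2 * normU12 N u := mul_nonneg (Real.sqrt_nonneg _) (normU12_nonneg _)
  rcases le_or_gt (N : ℤ) |j| with hj | hj
  · rwa [disp_apply_eq_zero u hj, abs_zero]
  have hcard : ((Icc (-(N : ℤ) + 1) j).card : ℝ) ≤ 2 * N := by
    rw [abs_lt] at hj
    rw [Int.card_Icc]
    exact_mod_cast (by omega : (j + 1 - (-(N : ℤ) + 1)).toNat ≤ 2 * N)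
  have hN : eps N * N = 1 := eps_mul_cast (by exact_mod_cast (abs_nonneg j).trans_lt hj)
  refine abs_le_of_sq_le_sq ?_ hbound
  calc (u : ℤ → ℝ) j ^ 2
    _ = eps N ^ 2 * (∑ l ∈ Icc (-(N : ℤ) + 1) j, strain N u l) ^ 2 := by
        rw [disp_apply_eq_sum_strain u hj, mul_pow]
    _ ≤ eps N ^ 2 * (2 * N * ∑ l ∈ bonds N, strain N u l ^ 2) := by
        refine mul_le_mul_of_nonneg_left (sq_sum_le_card_mul_sum_sq.trans ?_) (sq_nonneg _)
        have hsub : Icc (-(N : ℤ) + 1) j ⊆ bonds N :=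
          Icc_subset_Icc_right (le_of_lt (abs_lt.mp hj).2)
        exact mul_le_mul hcard (sum_le_sum_of_subset_of_nonneg hsub fun _ _ _ => sq_nonneg _)
          (sum_nonneg fun _ _ => sq_nonneg _) (by positivity)
    _ = 2 * (eps N * N) * (eps N * ∑ l ∈ bonds N, strain N u l ^ 2) := by ring
    _ = (√2 * normU12 N u) ^ 2 := by
        rw [hN, mul_pow, Real.sq_sqrt zero_le_two, normU12_sq, mul_one]

theorem normU12_eq_zero {u : Disp N} : normU12 N u = 0 ↔ u = 0 := by
  refine ⟨fun h => ?_, fun h => by simp [h, normU12, strain]⟩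
  ext j
  simpa [h] using abs_disp_apply_le u j

theorem normU12_pos {u : Disp N} (hu : u ≠ 0) : 0 < normU12 N u :=
  (normU12_nonneg _).lt_of_ne' (mt normU12_eq_zero.mp hu)

theorem opNormU12_nonneg (A : Module.End ℝ (Disp N)) : 0 ≤ opNormU12 N A :=
  Real.sSup_nonneg fun _ ⟨_, _, hr⟩ => hr ▸ div_nonneg (normU12_nonneg _) (normU12_nonneg _)

theorem opNormU12_le {A : Module.End ℝ (Disp N)} {M : ℝ} (hM : 0 ≤ M)
    (h : ∀ v : Disp N, normU12 N (A v) ≤ M * normU12 N v) : opNormU12 N A ≤ M := by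
  refine Real.sSup_le ?_ hM
  rintro _ ⟨v, hv, rfl⟩
  exact (div_le_iff₀ (normU12_pos hv)).mpr (h v)

theorem normU12_le_opNormU12_mul {A : Module.End ℝ (Disp N)} {M : ℝ}
    (h : ∀ v : Disp N, normU12 N (A v) ≤ M * normU12 N v) (v : Disp N) :
    normU12 N (A v) ≤ opNormU12 N A * normU12 N v := by
  rcases eq_or_ne v 0 with rfl | hv
  · simp [normU12, strain]
  rw [← div_le_iff₀ (normU12_pos hv)]
  refine le_csSup ⟨M, ?_⟩ ⟨v, hv, rfl⟩
  rintro _ ⟨w, hw, rfl⟩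
  exact (div_le_iff₀ (normU12_pos hw)).mpr (h w)

instance : FiniteDimensional ℝ (Disp N) := by
  let restrict : Disp N →ₗ[ℝ] (Icc (-(N : ℤ)) N → ℝ) :=
    LinearMap.funLeft ℝ ℝ (fun i : Icc (-(N : ℤ)) N => (i : ℤ)) ∘ₗ (Disp N).subtype
  refine FiniteDimensional.of_injective restrict fun u v huv => ?_
  ext j
  rcases le_or_gt (N : ℤ) |j| with hj | hj
  · rw [disp_apply_eq_zero u hj, disp_apply_eq_zero v hj]
  · exact congrFun huv ⟨j, mem_Icc.mpr (abs_le.mp hj.le)⟩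

/-- The operator `A` is coercive with constant `c` with respect to the `U^{1,2}` norm. -/
def CoerciveWith (c : ℝ) (A : Module.End ℝ (Disp N)) : Prop :=
  ∀ u : Disp N, c * normU12 N u ^ 2 ≤ ip N (A u) u

theorem CoerciveWith.mono {A : Module.End ℝ (Disp N)} {c c' : ℝ} (h : CoerciveWith c A)
    (hc : c' ≤ c) : CoerciveWith c' A :=
  fun u => (mul_le_mul_of_nonneg_right hc (sq_nonneg _)).trans (h u)

theorem CoerciveWith.mul_normU12_le {A : Module.End ℝ (Disp N)} {c B : ℝ} (h : CoerciveWith c A)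
    (hB : 0 ≤ B) {g : Disp N} (hg : ip N (A g) g ≤ B * normU12 N g) : c * normU12 N g ≤ B := by
  rcases (normU12_nonneg (N := N) g).eq_or_lt with h0 | hpos
  · rwa [← h0, mul_zero]
  · refine le_of_mul_le_mul_right ?_ hpos
    calc c * normU12 N g * normU12 N g = c * normU12 N g ^ 2 := by ring
      _ ≤ B * normU12 N g := (h g).trans hg

theorem CoerciveWith.isUnit {A : Module.End ℝ (Disp N)} {c : ℝ} (h : CoerciveWith c A)
    (hc : 0 < c) : IsUnit A := by
  rw [LinearMap.isUnit_iff_ker_eq_bot, LinearMap.ker_eq_bot']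
  intro u hu
  have hle : c * normU12 N u ≤ 0 := h.mul_normU12_le le_rfl (by simp [hu, ip])
  exact normU12_eq_zero.mp ((nonpos_of_mul_nonpos_right hle hc).antisymm (normU12_nonneg _))

/-- The multiplicity with which `-φ''_{2F} (d_{j+1} - d_j)²` enters the quadratic form of `L^{qce}`
when the interaction energy `(d_j + d_{j+1})²` across the atom `j` is rewritten as
`2 d_j² + 2 d_{j+1}² - (d_{j+1} - d_j)²`. -/
def jumpWeight (K : ℕ) (j : ℤ) : ℝ :=
  if j.natAbs < K then 1 else if j.natAbs ≤ K + 1 then 1 / 2 else 0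

/-- The multiplicity with which `φ''_{2F} d_l²` enters the quadratic form of `L^{qce}` after the
rewriting described at `jumpWeight`.  Its deviation from the value `4` of a homogeneous chain is
confined to the two interfaces. -/
def bondWeight (K : ℕ) (l : ℤ) : ℝ :=
  if l = K ∨ l = 1 - K then 3 else if l = K + 2 ∨ l = -K - 1 then 5 else 4

/-- The stress on the bond `l` produced by the strains `d`, in Jacobi form: the force `L^{qce} v`
is minus the discrete divergence of the stress of the strains of `v`. -/
def stress (K : ℕ) (a b : ℝ) (d : ℤ → ℝ) (l : ℤ) : ℝ :=
  (a + b * bondWeight K l) * d l +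
    b * (jumpWeight K l * (d (l + 1) - d l) - jumpWeight K (l - 1) * (d l - d (l - 1)))

theorem jumpWeight_neg (j : ℤ) : jumpWeight K (-j) = jumpWeight K j := by
  simp only [jumpWeight, Int.natAbs_neg]

theorem jumpWeight_nonneg (j : ℤ) : 0 ≤ jumpWeight K j := by
  unfold jumpWeight
  split_ifs <;> norm_num

theorem jumpWeight_of_lt {j : ℤ} (hj : j.natAbs < K) : jumpWeight K j = 1 := if_pos hj

theorem jumpWeight_of_mem_interface {j : ℤ} (hKj : K ≤ j.natAbs) (hj : j.natAbs ≤ K + 1) :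
    jumpWeight K j = 1 / 2 := by
  rw [jumpWeight, if_neg (by omega), if_pos hj]

theorem jumpWeight_of_gt {j : ℤ} (hj : K + 1 < j.natAbs) : jumpWeight K j = 0 := by
  rw [jumpWeight, if_neg (by omega), if_neg (by omega)]

theorem bondWeight_one_sub (l : ℤ) : bondWeight K (1 - l) = bondWeight K l := by
  unfold bondWeight
  congr 1
  · exact propext (by omega)
  · congr 1
    exact propext (by omega)

theorem bondWeight_of_eq {l : ℤ} (hl : l = K) : bondWeight K l = 3 := if_pos (Or.inl hl)

theorem bondWeight_of_eq_add_two {l : ℤ} (hl : l = K + 2) : bondWeight K l = 5 := by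
  rw [bondWeight, if_neg (by omega), if_pos (Or.inl hl)]

theorem bondWeight_of_ne {l : ℤ} (h₁ : l ≠ K) (h₂ : l ≠ K + 2) (h₃ : l ≠ 1 - K)
    (h₄ : l ≠ -K - 1) : bondWeight K l = 4 := by
  rw [bondWeight, if_neg (by omega), if_neg (by omega)]

theorem qceHalfRow_eq (hN : 0 < N) (hK : 2 ≤ K) (v : ℤ → ℝ) {j : ℤ} (hj : 0 ≤ j) :
    qceHalfRow N K a b v j =
      (stress K a b (strain N v) j - stress K a b (strain N v) (j + 1)) / eps N := by
  have hε : eps N ≠ 0 := (eps_pos hN).ne'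
  obtain h | h | h | h | h | h : j ≤ K - 2 ∨ j = K - 1 ∨ j = K ∨ j = K + 1 ∨ j = K + 2 ∨
      K + 3 ≤ j := by omega
  all_goals
    simp (disch := omega) only [qceHalfRow, stress, add_sub_cancel_right, if_pos, if_neg,
      jumpWeight_of_lt, jumpWeight_of_mem_interface, jumpWeight_of_gt, bondWeight_of_eq,
      bondWeight_of_eq_add_two, bondWeight_of_ne]
    simp only [lap1, lap2, strain, add_sub_cancel_right, sub_sub, add_assoc, one_add_one_eq_two]
    field_simp
    ring_nf

theorem stress_reflect (d : ℤ → ℝ) (l : ℤ) :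
    stress K a b (fun i => -d (1 - i)) l = -stress K a b d (1 - l) := by
  simp only [stress, bondWeight_one_sub, ← jumpWeight_neg (1 - l - 1), ← jumpWeight_neg (1 - l)]
  ring_nf

theorem qceRow_eq (hN : 0 < N) (hK : 2 ≤ K) (v : ℤ → ℝ) (j : ℤ) :
    qceRow N K a b v j =
      (stress K a b (strain N v) j - stress K a b (strain N v) (j + 1)) / eps N := by
  rcases le_or_gt 0 j with hj | hj
  · rw [qceRow, if_pos hj, qceHalfRow_eq hN hK v hj]
  · rw [qceRow, if_neg hj.not_ge, qceHalfRow_eq hN hK _ (by omega), funext (strain_comp_neg v),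
      stress_reflect, stress_reflect]
    ring_nf

theorem Lqce_apply_of_lt (u : Disp N) {j : ℤ} (hj : |j| < N) :
    (Lqce N K a b u : ℤ → ℝ) j = qceRow N K a b u j :=
  if_pos hj

theorem ip_Lqce (hN : 0 < N) (hK : 2 ≤ K) (u w : Disp N) :
    ip N (Lqce N K a b u) w =
      eps N * ∑ l ∈ bonds N, stress K a b (strain N u) l * strain N w l := by
  have hw : ∀ j : ℤ, (N : ℤ) ≤ |j| → (w : ℤ → ℝ) j = 0 := fun j => disp_apply_eq_zero w
  let σ := stress K a b (strain N u)
  calc ip N (Lqce N K a b u) w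
    _ = -∑ l ∈ bonds N, (w : ℤ → ℝ) l * (σ (l + 1) - σ l) := by
        rw [ip, mul_sum, ← sum_neg_distrib]
        refine sum_congr rfl fun l _ => ?_
        rcases le_or_gt (N : ℤ) |l| with hl | hl
        · simp [hw l hl]
        · rw [Lqce_apply_of_lt u hl, qceRow_eq hN hK]
          field_simp [(eps_pos hN).ne']
          ring
    _ = ∑ l ∈ bonds N, ((w : ℤ → ℝ) l - (w : ℤ → ℝ) (l - 1)) * σ l := by
        rw [sum_Icc_sub_pred_mul _ _ (by omega), hw N (by simp), hw (-N) (by simp)]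
        ring
    _ = eps N * ∑ l ∈ bonds N, σ l * strain N w l := by
        simp only [← eps_mul_strain hN, mul_sum]
        exact sum_congr rfl fun l _ => by ring

theorem stress_of_far (d : ℤ → ℝ) {l : ℤ} (hl : l < -K - 1 ∨ K + 2 < l) :
    stress K a b d l = (a + 4 * b) * d l := by
  rw [stress, bondWeight_of_ne (by omega) (by omega) (by omega) (by omega),
    jumpWeight_of_gt (by omega), jumpWeight_of_gt (by omega)]
  ring

/-- The quadratic form of the interface and next-nearest-neighbour corrections to the local model,
as a function of the strains `d`; see `ip_Lqce_self`. -/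
def defectForm (N K : ℕ) (d : ℤ → ℝ) : ℝ :=
  ∑ l ∈ bonds N, (jumpWeight K l * (d (l + 1) - d l) ^ 2 + (4 - bondWeight K l) * d l ^ 2)

theorem sum_stress_mul_self (hKN : K + 2 ≤ N) (d : ℤ → ℝ) :
    ∑ l ∈ bonds N, stress K a b d l * d l =
      (a + 4 * b) * ∑ l ∈ bonds N, d l ^ 2 - b * defectForm N K d := by
  let flux (l : ℤ) : ℝ := jumpWeight K l * (d (l + 1) - d l)
  have hflux : ∑ l ∈ bonds N, (flux l - flux (l - 1)) * d l =
      -∑ l ∈ bonds N, jumpWeight K l * (d (l + 1) - d l) ^ 2 := by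
    have hleft : flux (-N) = 0 := by
      simp only [flux]; rw [jumpWeight_of_gt (by omega), zero_mul]
    have hright : flux N = 0 := by
      simp only [flux]; rw [jumpWeight_of_gt (by omega), zero_mul]
    rw [sum_Icc_sub_pred_mul flux d (by omega), hleft, hright]
    simp only [flux, sq, mul_assoc]
    ring
  calc ∑ l ∈ bonds N, stress K a b d l * d l
    _ = ∑ l ∈ bonds N, ((a + 4 * b) * d l ^ 2 - b * ((4 - bondWeight K l) * d l ^ 2) +
          b * ((flux l - flux (l - 1)) * d l)) := by
        refine sum_congr rfl fun l _ => ?_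
        simp only [stress, flux, sub_add_cancel]
        ring
    _ = (a + 4 * b) * ∑ l ∈ bonds N, d l ^ 2 - b * defectForm N K d := by
        rw [sum_add_distrib, sum_sub_distrib, ← mul_sum, ← mul_sum, ← mul_sum, hflux, defectForm,
          sum_add_distrib]
        ring

theorem ip_Lqce_self (hK : 2 ≤ K) (hKN : K + 2 ≤ N) (u : Disp N) :
    ip N (Lqce N K a b u) u =
      (a + 4 * b) * normU12 N u ^ 2 - b * (eps N * defectForm N K (strain N u)) := by
  rw [ip_Lqce (by omega) hK, sum_stress_mul_self hKN, normU12_sq]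
  ring

theorem neg_sum_sq_le_defectForm (d : ℤ → ℝ) : -∑ l ∈ bonds N, d l ^ 2 ≤ defectForm N K d := by
  rw [← sum_neg_distrib, defectForm]
  refine sum_le_sum fun l _ => ?_
  have hbond : bondWeight K l ≤ 5 := by
    unfold bondWeight
    split_ifs <;> norm_num
  nlinarith [mul_nonneg (jumpWeight_nonneg (K := K) l) (sq_nonneg (d (l + 1) - d l)),
    sq_nonneg (d l)]

theorem two_mul_jumpWeight_add_le_bondWeight (hK : 2 ≤ K) (l : ℤ) :
    2 * (jumpWeight K (l - 1) + jumpWeight K l) ≤ bondWeight K l := by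
  unfold jumpWeight bondWeight
  split_ifs <;> first | omega | norm_num

theorem defectForm_le_four_mul_sum_sq (hK : 2 ≤ K) (hKN : K + 2 ≤ N) (d : ℤ → ℝ) :
    defectForm N K d ≤ 4 * ∑ l ∈ bonds N, d l ^ 2 := by
  let w := jumpWeight K
  have hshift : ∑ l ∈ bonds N, w l * d (l + 1) ^ 2 = ∑ l ∈ bonds N, w (l - 1) * d l ^ 2 := by
    have htele := sum_Icc_sub_pred (fun l => w l * d (l + 1) ^ 2) (show -(N : ℤ) ≤ N by omega)
    simp only [sub_add_cancel, w] at htele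
    rw [jumpWeight_of_gt (by omega), jumpWeight_of_gt (by omega), sum_sub_distrib] at htele
    linarith
  calc defectForm N K d
    _ ≤ ∑ l ∈ bonds N, (2 * (w l * d (l + 1) ^ 2) + 2 * (w l * d l ^ 2) +
          (4 - bondWeight K l) * d l ^ 2) := by
        refine sum_le_sum fun l _ => ?_
        nlinarith [mul_nonneg (jumpWeight_nonneg (K := K) l) (sq_nonneg (d (l + 1) + d l))]
    _ = ∑ l ∈ bonds N, (2 * (w (l - 1) + w l) + (4 - bondWeight K l)) * d l ^ 2 := by
        rw [sum_add_distrib, sum_add_distrib, ← mul_sum, hshift, mul_sum, ← sum_add_distrib,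
          ← sum_add_distrib]
        exact sum_congr rfl fun l _ => by ring
    _ ≤ 4 * ∑ l ∈ bonds N, d l ^ 2 := by
        rw [mul_sum]
        refine sum_le_sum fun l _ => mul_le_mul_of_nonneg_right ?_ (sq_nonneg _)
        linarith [two_mul_jumpWeight_add_le_bondWeight hK l]

theorem coerciveWith_Lqce_of_nonneg (hK : 2 ≤ K) (hKN : K + 2 ≤ N) (hb : 0 ≤ b) :
    CoerciveWith a (Lqce N K a b) := by
  intro u
  have hform : eps N * defectForm N K (strain N u) ≤ 4 * normU12 N u ^ 2 := by
    rw [normU12_sq, mul_left_comm]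
    exact mul_le_mul_of_nonneg_left (defectForm_le_four_mul_sum_sq hK hKN _) eps_nonneg
  rw [ip_Lqce_self hK hKN]
  linarith [mul_le_mul_of_nonneg_left hform hb]

theorem ip_Lqce_four_neg_one (hK : 2 ≤ K) (hKN : K + 2 ≤ N) (u : Disp N) :
    ip N (Lqce N K 4 (-1) u) u = eps N * defectForm N K (strain N u) := by
  rw [ip_Lqce_self hK hKN]
  ring

theorem qceStab_le_ip (hK : 2 ≤ K) (hKN : K + 2 ≤ N) {u : Disp N} (hu : normU12 N u = 1) :
    qceStab K 4 (-1) ≤ ip N (Lqce N K 4 (-1) u) u := by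
  refine csInf_le ⟨-1, ?_⟩ ⟨N, hKN, u, hu, rfl⟩
  rintro _ ⟨M, hKM, v, hv, rfl⟩
  calc (-1 : ℝ) = eps M * -∑ l ∈ bonds M, strain M v l ^ 2 := by
        rw [mul_neg, ← normU12_sq, hv, one_pow]
    _ ≤ eps M * defectForm M K (strain M v) :=
        mul_le_mul_of_nonneg_left (neg_sum_sq_le_defectForm _) eps_nonneg
    _ = ip M (Lqce M K 4 (-1) v) v := (ip_Lqce_four_neg_one hK hKM v).symm

theorem neg_lamK_mul_normU12_sq_le (hK : 2 ≤ K) (hKN : K + 2 ≤ N) (u : Disp N) :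
    -lamK K * normU12 N u ^ 2 ≤ eps N * defectForm N K (strain N u) := by
  rcases eq_or_ne u 0 with rfl | hu
  · simp [normU12, defectForm, strain]
  have hpos := normU12_pos hu
  have hunit : normU12 N ((normU12 N u)⁻¹ • u : Disp N) = 1 := by
    rw [Submodule.coe_smul, normU12_smul, abs_of_pos (inv_pos.mpr hpos), inv_mul_cancel₀ hpos.ne']
  have hstab := qceStab_le_ip hK hKN hunit
  rw [map_smul, Submodule.coe_smul, Submodule.coe_smul, ip_smul_smul, inv_pow,
    ← div_eq_inv_mul, le_div_iff₀ (by positivity), ip_Lqce_four_neg_one hK hKN] at hstab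
  rwa [lamK, neg_neg]

theorem coerciveWith_Lqce_of_nonpos (hK : 2 ≤ K) (hKN : K + 2 ≤ N) (hb : b ≤ 0) :
    CoerciveWith (a + 4 * b + lamK K * b) (Lqce N K a b) := by
  intro u
  rw [ip_Lqce_self hK hKN]
  linarith [mul_le_mul_of_nonpos_left (neg_lamK_mul_normU12_sq_le hK hKN u) hb]

/-- The part of `defectForm` that lives on one half of the chain, as a function of the strains
`r 0, r 1, …` of the bonds `1, 2, …` on that half; see `defectForm_eq`. -/
def halfForm (N K : ℕ) (r : ℕ → ℝ) : ℝ :=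
  ∑ i ∈ range N, (jumpWeight K (i + 1) * (r (i + 1) - r i) ^ 2 +
    (4 - bondWeight K (i + 1)) * r i ^ 2)

theorem defectForm_eq (hK : 0 < K) (hKN : K + 2 ≤ N) (d : ℤ → ℝ) :
    defectForm N K d = (d 1 - d 0) ^ 2 + halfForm N K (fun i => d (i + 1)) +
      halfForm N K (fun i => d (-i)) := by
  let jump (i : ℕ) : ℝ := jumpWeight K i * (d (-i) - d (1 - i)) ^ 2
  have hjump : ∑ i ∈ range N, jump i = ∑ i ∈ range N, jump (i + 1) + (d 1 - d 0) ^ 2 := by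
    have hzero : jump 0 = (d 1 - d 0) ^ 2 := by
      simp only [jump]
      rw [jumpWeight_of_lt (by omega)]
      simp
      ring
    have hlast : jump N = 0 := by
      simp only [jump]
      rw [jumpWeight_of_gt (by omega), zero_mul]
    rw [← hzero, ← sum_range_succ', sum_range_succ, hlast, add_zero]
  have hright : ∑ i ∈ range N, (jumpWeight K (i + 1) * (d (i + 1 + 1) - d (i + 1)) ^ 2 +
      (4 - bondWeight K (i + 1)) * d (i + 1) ^ 2) = halfForm N K (fun i => d (i + 1)) := by
    simp only [halfForm, Nat.cast_add, Nat.cast_one]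
  have hleft : ∑ i ∈ range N, (jumpWeight K (-i) * (d (-i + 1) - d (-i)) ^ 2 +
      (4 - bondWeight K (-i)) * d (-i) ^ 2) =
      (d 1 - d 0) ^ 2 + halfForm N K (fun i => d (-i)) := by
    calc _ = ∑ i ∈ range N, (jump i + (4 - bondWeight K (i + 1)) * d (-i) ^ 2) := by
          refine sum_congr rfl fun i _ => ?_
          rw [jumpWeight_neg, ← bondWeight_one_sub (i + 1 : ℤ)]
          simp only [jump]
          ring_nf
      _ = _ := by
          rw [sum_add_distrib, hjump, halfForm, sum_add_distrib]
          simp only [jump, Nat.cast_add, Nat.cast_one, sub_add_cancel_right]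
          ring
  rw [defectForm, sum_bonds_eq_sum_range, hright, hleft]
  ring

theorem halfForm_congr (hKN : K + 2 ≤ N) {r r' : ℕ → ℝ} (h : ∀ i < N, r i = r' i) :
    halfForm N K r = halfForm N K r' := by
  refine sum_congr rfl fun i hi => ?_
  rw [mem_range] at hi
  rw [h i hi]
  rcases Nat.lt_or_ge (i + 1) N with hi' | hi'
  · rw [h (i + 1) hi']
  · rw [jumpWeight_of_gt (by omega), zero_mul, zero_mul]

theorem halfForm_eq_of_le (hKN : K + 2 ≤ N) {M : ℕ} (hNM : N ≤ M) (r : ℕ → ℝ) :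
    halfForm M K r = halfForm N K r := by
  refine (sum_subset (range_mono hNM) fun i _ hi => ?_).symm
  rw [mem_range] at hi
  rw [jumpWeight_of_gt (by omega), bondWeight_of_ne (by omega) (by omega) (by omega) (by omega)]
  ring

theorem jumpWeight_succ {j : ℤ} (hj : 0 ≤ j) : jumpWeight (K + 1) (j + 1) = jumpWeight K j := by
  unfold jumpWeight
  congr 1
  · exact propext (by omega)
  · congr 1
    exact propext (by omega)

theorem bondWeight_succ (hK : 0 < K) {l : ℤ} (hl : 0 < l) :
    bondWeight (K + 1) (l + 1) = bondWeight K l := by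
  unfold bondWeight
  congr 1
  · exact propext (by omega)
  · congr 1
    exact propext (by omega)

theorem halfForm_comp_succ_le (hK : 2 ≤ K) (r : ℕ → ℝ) :
    halfForm N K (fun i => r (i + 1)) ≤ halfForm (N + 1) (K + 1) r := by
  rw [halfForm, halfForm, sum_range_succ']
  have hfirst : 0 ≤ jumpWeight (K + 1) ((0 : ℕ) + 1) * (r (0 + 1) - r 0) ^ 2 +
      (4 - bondWeight (K + 1) ((0 : ℕ) + 1)) * r 0 ^ 2 := by
    rw [bondWeight_of_ne (by omega) (by omega) (by omega) (by omega), sub_self, zero_mul, add_zero]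
    exact mul_nonneg (jumpWeight_nonneg _) (sq_nonneg _)
  refine le_add_of_le_of_nonneg (sum_le_sum fun i _ => le_of_eq ?_) hfirst
  push_cast
  rw [jumpWeight_succ (by omega), bondWeight_succ (by omega) (by omega)]

theorem neg_lamK_mul_sum_sq_le_halfForm_of_sum_eq_zero (hK : 2 ≤ K) (hKN : K + 2 ≤ N) {r : ℕ → ℝ}
    (hr : ∑ i ∈ range N, r i = 0) :
    -lamK K * ∑ i ∈ range N, r i ^ 2 ≤ halfForm N K r := by
  let d (l : ℤ) : ℝ := r (max (l - 1) (-l)).toNat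
  have hd_right (i : ℕ) : d (i + 1) = r i := congrArg r (by omega)
  have hd_left (i : ℕ) : d (-i) = r i := congrArg r (by omega)
  obtain ⟨u, hu⟩ := exists_strain_eq (d := d) (show 0 < N by omega) (by
    simp only [sum_bonds_eq_sum_range, hd_right, hd_left, hr, add_zero])
  have hu_right : ∀ i < N, strain N u (i + 1) = r i := fun i hi => by
    rw [hu _ (by rw [mem_Icc]; omega), hd_right]
  have hu_left : ∀ i < N, strain N u (-i) = r i := fun i hi => by
    rw [hu _ (by rw [mem_Icc]; omega), hd_left]
  have hcoer := neg_lamK_mul_normU12_sq_le hK hKN u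
  have h01 : strain N u 1 = strain N u 0 := by
    simpa using (hu_right 0 (by omega)).trans (hu_left 0 (by omega)).symm
  rw [normU12_sq, mul_left_comm, mul_le_mul_iff_right₀ (eps_pos (by omega)),
    defectForm_eq (by omega) hKN, h01, halfForm_congr hKN hu_right, halfForm_congr hKN hu_left,
    sum_congr rfl fun l hl => by rw [hu l hl], sum_bonds_eq_sum_range] at hcoer
  simp only [hd_right, hd_left] at hcoer
  linarith

theorem neg_lamK_mul_sum_sq_le_halfForm (hK : 2 ≤ K) (hKN : K + 2 ≤ N) (r : ℕ → ℝ) :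
    -lamK K * ∑ i ∈ range N, r i ^ 2 ≤ halfForm N K r := by
  -- A constant tail of length `m + 1` makes the mean of `r` vanish and adds only
  -- `O(1 / (m + 1))` to the sum of squares.
  let s := ∑ i ∈ range N, r i
  have htail (m : ℕ) :
      -lamK K * (∑ i ∈ range N, r i ^ 2 + s ^ 2 * (1 / ((m : ℝ) + 1))) ≤ halfForm N K r := by
    let r' (i : ℕ) : ℝ := if i < N then r i else -s / (m + 1)
    have hhead : ∀ i < N, r' i = r i := fun i hi => if_pos hi
    have htail' (i : ℕ) : r' (N + i) = -s / (m + 1) := if_neg (by omega)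
    have hm : (m : ℝ) + 1 ≠ 0 := by positivity
    have hsum : ∑ i ∈ range (N + (m + 1)), r' i = 0 := by
      rw [sum_range_add, sum_congr rfl fun i hi => hhead i (mem_range.mp hi)]
      simp only [htail', sum_const, card_range, nsmul_eq_mul, Nat.cast_add, Nat.cast_one]
      field_simp
      simp [s]
    have hsum_sq : ∑ i ∈ range (N + (m + 1)), r' i ^ 2 =
        ∑ i ∈ range N, r i ^ 2 + s ^ 2 * (1 / ((m : ℝ) + 1)) := by
      rw [sum_range_add, sum_congr rfl fun i hi => by rw [hhead i (mem_range.mp hi)]]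
      simp only [htail', sum_const, card_range, nsmul_eq_mul, Nat.cast_add, Nat.cast_one]
      field_simp
    rw [← hsum_sq, ← halfForm_congr hKN hhead, ← halfForm_eq_of_le hKN (Nat.le_add_right N (m + 1))]
    exact neg_lamK_mul_sum_sq_le_halfForm_of_sum_eq_zero hK (by omega) hsum
  have hlim := (((tendsto_one_div_add_atTop_nhds_zero_nat (𝕜 := ℝ)).const_mul (s ^ 2)).const_add
    (∑ i ∈ range N, r i ^ 2)).const_mul (-lamK K)
  rw [mul_zero, add_zero] at hlim
  exact le_of_tendsto' hlim htail

theorem one_half_le_lamK (hK : 2 ≤ K) : 1 / 2 ≤ lamK K := by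
  let r : ℕ → ℝ := Pi.single (K + 1) 1
  have hr : ∀ i < K + 1, r i = 0 := fun i hi => Pi.single_eq_of_ne hi.ne _
  have hform := neg_lamK_mul_sum_sq_le_halfForm hK le_rfl r
  have hzero : ∑ i ∈ range K, (jumpWeight K (i + 1) * (r (i + 1) - r i) ^ 2 +
      (4 - bondWeight K (i + 1)) * r i ^ 2) = 0 := by
    refine sum_eq_zero fun i hi => ?_
    rw [mem_range] at hi
    rw [hr i (by omega), hr (i + 1) (by omega)]
    ring
  have hsq : ∑ i ∈ range (K + 1), r i ^ 2 = 0 :=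
    sum_eq_zero fun i hi => by rw [hr i (mem_range.mp hi), zero_pow two_ne_zero]
  rw [halfForm, sum_range_succ, hsq, sum_range_succ, sum_range_succ, hzero, hr K (by omega),
    jumpWeight_of_mem_interface (by omega) (by omega), jumpWeight_of_gt (by omega),
    bondWeight_of_eq_add_two (l := (K + 1 : ℕ) + 1) (by omega)] at hform
  simp only [r, Pi.single_eq_same] at hform
  linarith

theorem lamK_succ_le (hK : 2 ≤ K) : lamK (K + 1) ≤ lamK K := by
  have hlam : 0 ≤ lamK K := one_half_pos.le.trans (one_half_le_lamK hK)
  have hhalf {n : ℕ} (hn : K + 2 ≤ n) (r : ℕ → ℝ) :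
      -lamK K * ∑ i ∈ range (n + 1), r i ^ 2 ≤ halfForm (n + 1) (K + 1) r := by
    refine le_trans ?_ ((neg_lamK_mul_sum_sq_le_halfForm hK hn fun i => r (i + 1)).trans
      (halfForm_comp_succ_le hK r))
    rw [sum_range_succ']
    nlinarith [sq_nonneg (r 0)]
  rw [lamK, neg_le]
  refine Real.le_sInf ?_ (neg_nonpos.mpr hlam)
  rintro _ ⟨N, hKN, u, hu, rfl⟩
  obtain ⟨n, rfl⟩ : ∃ n, N = n + 1 := ⟨N - 1, by omega⟩
  have hright := hhalf (n := n) (by omega) fun i => strain (n + 1) u (i + 1)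
  have hleft := hhalf (n := n) (by omega) fun i => strain (n + 1) u (-i)
  calc -lamK K
    _ = eps (n + 1) * (-lamK K * ∑ l ∈ bonds (n + 1), strain (n + 1) u l ^ 2) := by
        rw [mul_left_comm, ← normU12_sq, hu, one_pow, mul_one]
    _ ≤ eps (n + 1) * defectForm (n + 1) (K + 1) (strain (n + 1) u) := by
        refine mul_le_mul_of_nonneg_left ?_ eps_nonneg
        rw [defectForm_eq (by omega) (by omega), sum_bonds_eq_sum_range]
        linarith [sq_nonneg (strain (n + 1) u 1 - strain (n + 1) u 0)]
    _ = ip (n + 1) (Lqce (n + 1) (K + 1) 4 (-1) u) u :=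
        (ip_Lqce_four_neg_one (by omega) hKN u).symm

theorem antitoneOn_lamK : AntitoneOn lamK (Set.Ici 2) :=
  antitoneOn_nat_Ici_of_succ_le fun _ hK => lamK_succ_le hK

theorem exists_uniform_coercivity (b : ℝ) (ha : 0 < a) :
    ∃ c : ℝ, 0 < c ∧ ∀ N K : ℕ, 2 ≤ K → K + 2 ≤ N → 0 < a + 4 * b + lamK K * b →
      CoerciveWith c (Lqce N K a b) := by
  rcases le_or_gt 0 b with hb | hb
  · exact ⟨a, ha, fun N K hK hKN _ => coerciveWith_Lqce_of_nonneg hK hKN hb⟩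
  by_cases hex : ∃ K, 2 ≤ K ∧ 0 < a + 4 * b + lamK K * b
  · classical
    have hmin := Nat.find_spec hex
    refine ⟨_, hmin.2, fun N K hK hKN hpos => (coerciveWith_Lqce_of_nonpos hK hKN hb.le).mono ?_⟩
    have hle : lamK K ≤ lamK (Nat.find hex) :=
      antitoneOn_lamK hmin.1 hK (Nat.find_min' hex ⟨hK, hpos⟩)
    linarith [mul_le_mul_of_nonpos_right hle hb.le]
  · exact ⟨1, one_pos, fun N K hK _ hpos => absurd ⟨K, hK, hpos⟩ hex⟩

/-- The atoms of the right interface, where the rows of `L^{qce}` and `L^{qcf}` differ. -/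
abbrev interface (K : ℕ) : Finset ℤ := Icc ((K : ℤ) - 1) (K + 2)

/-- The rows of `L^{qce} - L^{qcf}` at the right interface, divided by `φ''_{2F} / ε`, as a function
of the strains `d`; see `Lqce_sub_Lqcf_apply`. -/
def interfaceForce (K : ℕ) (d : ℤ → ℝ) (j : ℤ) : ℝ :=
  if j = (K : ℤ) - 1 then (d K + d (K + 1)) / 2
  else if j = K then (d (K + 2) - 3 * d (K + 1)) / 2
  else if j = K + 1 then (d K - 3 * d (K + 1)) / 2
  else if j = K + 2 then (d (K + 1) + d (K + 2)) / 2
  else 0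

theorem interfaceForce_of_notMem (d : ℤ → ℝ) {j : ℤ} (hj : j ∉ interface K) :
    interfaceForce K d j = 0 := by
  rw [mem_Icc] at hj
  rw [interfaceForce, if_neg (by omega), if_neg (by omega), if_neg (by omega), if_neg (by omega)]

theorem abs_interfaceForce_le {d : ℤ → ℝ} {M : ℝ} (hd : ∀ l, |d l| ≤ M) (j : ℤ) :
    |interfaceForce K d j| ≤ 2 * M := by
  simp only [abs_le] at hd ⊢
  have hK := hd K
  have hK₁ := hd (K + 1)
  have hK₂ := hd (K + 2)
  unfold interfaceForce
  split_ifs <;> constructor <;> linarith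

theorem sum_interfaceForce (d : ℤ → ℝ) :
    ∑ j ∈ interface K, interfaceForce K d j = d K - 2 * d (K + 1) + d (K + 2) := by
  have hinterface : interface K = {(K : ℤ) - 1, (K : ℤ), (K : ℤ) + 1, (K : ℤ) + 2} := by
    ext j
    simp only [mem_Icc, mem_insert, mem_singleton]
    omega
  rw [hinterface, sum_insert (by simp; omega), sum_insert (by simp), sum_insert (by simp),
    sum_singleton]
  simp (disch := omega) only [interfaceForce, if_true, if_neg]
  ring

theorem qceHalfRow_sub_qcfRow (hN : 0 < N) (v : ℤ → ℝ) {j : ℤ} (hj : 0 ≤ j) :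
    qceHalfRow N K a b v j - qcfRow N K a b v j =
      b / eps N * interfaceForce K (strain N v) j := by
  have hε : eps N ≠ 0 := (eps_pos hN).ne'
  rw [qcfRow, abs_of_nonneg hj]
  obtain h | h | h | h | h | h : j ≤ K - 2 ∨ j = K - 1 ∨ j = K ∨ j = K + 1 ∨ j = K + 2 ∨
      K + 3 ≤ j := by omega
  all_goals
    simp (disch := omega) only [qceHalfRow, atRow, qclRow, interfaceForce, if_pos, if_neg]
    try subst h
    simp only [lap1, lap2, strain]
    field_simp
    ring_nf

theorem qcfRow_neg (v : ℤ → ℝ) (j : ℤ) :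
    qcfRow N K a b (fun i => v (-i)) (-j) = qcfRow N K a b v j := by
  simp only [qcfRow, atRow, qclRow, lap1, lap2, abs_neg, neg_add, neg_sub', neg_neg, sub_neg_eq_add,
    ← sub_eq_add_neg]
  split_ifs <;> ring

theorem qceRow_sub_qcfRow (hN : 0 < N) (hK : 2 ≤ K) (v : ℤ → ℝ) (j : ℤ) :
    qceRow N K a b v j - qcfRow N K a b v j =
      b / eps N * (interfaceForce K (strain N v) j +
        interfaceForce K (strain N fun i => v (-i)) (-j)) := by
  rcases le_or_gt 0 j with hj | hj
  · rw [qceRow, if_pos hj, qceHalfRow_sub_qcfRow hN v hj,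
      interfaceForce_of_notMem (j := -j) _ (by rw [mem_Icc]; omega), add_zero]
  · rw [qceRow, if_neg hj.not_ge, ← qcfRow_neg, qceHalfRow_sub_qcfRow hN _ (by omega),
      interfaceForce_of_notMem (j := j) _ (by rw [mem_Icc]; omega), zero_add]

theorem Lqce_sub_Lqcf_apply (hN : 0 < N) (hK : 2 ≤ K) (v : Disp N) {j : ℤ} (hj : |j| < N) :
    (((Lqce N K a b - Lqcf N K a b) v : Disp N) : ℤ → ℝ) j =
      b / eps N * (interfaceForce K (strain N v) j +
        interfaceForce K (strain N fun i => (v : ℤ → ℝ) (-i)) (-j)) := by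
  rw [← qceRow_sub_qcfRow hN hK, LinearMap.sub_apply]
  exact congrArg₂ (fun x y : ℝ => x - y) (if_pos hj) (if_pos hj)

theorem ip_Lqce_sub_Lqcf (hK : 2 ≤ K) (hKN : K + 2 < N) (v g : Disp N) :
    ip N ((Lqce N K a b - Lqcf N K a b) v : Disp N) g =
      b * ∑ j ∈ interface K, (interfaceForce K (strain N v) j * (g : ℤ → ℝ) j +
        interfaceForce K (strain N fun i => (v : ℤ → ℝ) (-i)) j * (g : ℤ → ℝ) (-j)) := by
  have hN : 0 < N := by omega
  let F := interfaceForce K (strain N v)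
  let F' := interfaceForce K (strain N fun i => (v : ℤ → ℝ) (-i))
  have hright : ∑ j ∈ bonds N, F j * (g : ℤ → ℝ) j = ∑ j ∈ interface K, F j * (g : ℤ → ℝ) j :=
    (sum_subset (Icc_subset_Icc (by omega) (by omega)) fun j _ hj => by
      simp only [F, interfaceForce_of_notMem _ hj, zero_mul]).symm
  have hleft : ∑ j ∈ bonds N, F' (-j) * (g : ℤ → ℝ) j =
      ∑ j ∈ interface K, F' j * (g : ℤ → ℝ) (-j) := by
    refine (sum_of_injOn (fun j : ℤ => -j) neg_injective.injOn (fun j hj => ?_)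
      (fun j _ hj => ?_) fun j _ => by rw [neg_neg]).symm
    · simp only [coe_Icc, Set.mem_Icc] at hj ⊢
      omega
    · have hj' : -j ∉ interface K := fun h => hj ⟨-j, h, neg_neg j⟩
      simp only [F', interfaceForce_of_notMem _ hj', zero_mul]
  rw [sum_add_distrib, ← hright, ← hleft, ← sum_add_distrib, mul_sum, ip, mul_sum]
  refine sum_congr rfl fun j _ => ?_
  rcases le_or_gt (N : ℤ) |j| with hj | hj
  · simp [disp_apply_eq_zero g hj]
  · rw [Lqce_sub_Lqcf_apply hN hK v hj]
    field_simp [(eps_pos hN).ne']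
    simp only [F, F']
    ring

theorem abs_ip_Lqce_sub_Lqcf_le (hK : 2 ≤ K) (hKN : K + 2 < N) (v g : Disp N) :
    |ip N ((Lqce N K a b - Lqcf N K a b) v : Disp N) g| ≤
      16 * √2 * |b| * √N * normU12 N v * normU12 N g := by
  have hstrain := abs_strain_le v
  have hstrain' (l : ℤ) : |strain N (fun i => (v : ℤ → ℝ) (-i)) l| ≤ √N * normU12 N v := by
    rw [strain_comp_neg, abs_neg]
    exact hstrain _
  have hterm {d : ℤ → ℝ} (hd : ∀ l, |d l| ≤ √N * normU12 N v) (i j : ℤ) :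
      |interfaceForce K d i * (g : ℤ → ℝ) j| ≤
        2 * (√N * normU12 N v) * (√2 * normU12 N g) := by
    rw [abs_mul]
    exact mul_le_mul (abs_interfaceForce_le (K := K) hd i) (abs_disp_apply_le g j) (abs_nonneg _)
      ((abs_nonneg _).trans (abs_interfaceForce_le (K := K) hd i))
  have hcard : #(interface K) = 4 := by
    rw [Int.card_Icc]
    omega
  rw [ip_Lqce_sub_Lqcf hK hKN, abs_mul]
  calc |b| * |∑ j ∈ interface K, _|
    _ ≤ |b| * (#(interface K) • (2 * (2 * (√N * normU12 N v) * (√2 * normU12 N g)))) := by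
        refine mul_le_mul_of_nonneg_left ?_ (abs_nonneg b)
        refine (abs_sum_le_sum_abs _ _).trans (sum_le_card_nsmul _ _ _ fun j _ => ?_)
        rw [two_mul]
        exact (abs_add_le _ _).trans (add_le_add (hterm hstrain j j) (hterm hstrain' j (-j)))
    _ = 16 * √2 * |b| * √N * normU12 N v * normU12 N g := by
        rw [hcard]
        simp only [nsmul_eq_mul, Nat.cast_ofNat]
        ring

theorem Lqce_Gqce_apply (h : IsUnit (Lqce N K a b)) (v : Disp N) :
    Lqce N K a b (Gqce N K a b v) = (Lqce N K a b - Lqcf N K a b) v := by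
  have hcancel := LinearMap.congr_fun (Ring.mul_inverse_cancel _ h) (Lqcf N K a b v)
  rw [Module.End.mul_apply, Module.End.one_apply] at hcancel
  rw [Gqce, LinearMap.sub_apply, map_sub, LinearMap.sub_apply, Module.End.one_apply,
    Module.End.mul_apply, hcancel]

theorem normU12_Gqce_le (hK : 2 ≤ K) (hKN : K + 2 < N) {c : ℝ} (hc : 0 < c)
    (hcoer : CoerciveWith c (Lqce N K a b)) (v : Disp N) :
    normU12 N (Gqce N K a b v) ≤ 16 * √2 * |b| / c * √N * normU12 N v := by
  have hv := normU12_nonneg (N := N) v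
  have hmain : c * normU12 N (Gqce N K a b v) ≤ 16 * √2 * |b| * √N * normU12 N v := by
    refine hcoer.mul_normU12_le (by positivity) ?_
    rw [Lqce_Gqce_apply (hcoer.isUnit hc)]
    exact (le_abs_self _).trans (abs_ip_Lqce_sub_Lqcf_le hK hKN v _)
  calc normU12 N (Gqce N K a b v) ≤ 16 * √2 * |b| * √N * normU12 N v / c :=
        (le_div_iff₀' hc).mpr hmain
    _ = 16 * √2 * |b| / c * √N * normU12 N v := by ring

theorem opNormU12_Gqce_le (hK : 2 ≤ K) (hKN : K + 2 < N) {c : ℝ} (hc : 0 < c)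
    (hcoer : CoerciveWith c (Lqce N K a b)) :
    opNormU12 N (Gqce N K a b) ≤ 16 * √2 * |b| / c * √N :=
  opNormU12_le (by positivity) (normU12_Gqce_le hK hKN hc hcoer)

/-- The displacement `min (N - |j|, N - K - 2) / N`, which is constant on the atomistic region and
both interfaces and linear from there to the clamped ends.  The truncated subtraction makes it
vanish at `|j| ≥ N`. -/
def plateau (N K : ℕ) : Disp N :=
  ⟨fun j => (N - max j.natAbs (K + 2) : ℕ) * eps N, fun j hj => by
    rw [Int.abs_eq_natAbs] at hj
    beta_reduce
    rw [Nat.sub_eq_zero_of_le (by omega), Nat.cast_zero, zero_mul]⟩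

theorem plateau_apply (j : ℤ) :
    (plateau N K : ℤ → ℝ) j = (N - max j.natAbs (K + 2) : ℕ) * eps N :=
  rfl

theorem strain_plateau (hN : 0 < N) (l : ℤ) :
    strain N (plateau N K) l =
      (N - max l.natAbs (K + 2) : ℕ) - (N - max (l - 1).natAbs (K + 2) : ℕ) := by
  rw [strain, plateau_apply, plateau_apply, ← sub_mul, mul_div_cancel_right₀ _ (eps_pos hN).ne']

theorem abs_strain_plateau_le_one (hN : 0 < N) (l : ℤ) : |strain N (plateau N K) l| ≤ 1 := by
  rw [strain_plateau hN, abs_sub_le_iff, sub_le_iff_le_add, sub_le_iff_le_add]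
  constructor <;> norm_cast <;> omega

theorem strain_plateau_eq_zero (hN : 0 < N) {l : ℤ} (hl : -K - 1 ≤ l) (hl' : l ≤ K + 2) :
    strain N (plateau N K) l = 0 := by
  rw [strain_plateau hN, max_eq_right (by omega), max_eq_right (by omega), sub_self]

theorem normU12_plateau_le (hN : 0 < N) : normU12 N (plateau N K) ≤ √2 := by
  refine Real.le_sqrt_of_sq_le ?_
  have hsum := sum_le_card_nsmul (bonds N) (fun l => strain N (plateau N K) l ^ 2) 1 fun l _ =>
    (sq_le_one_iff_abs_le_one _).mpr (abs_strain_plateau_le_one hN l)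
  have hcard : #(bonds N) = 2 * N := by
    rw [Int.card_Icc]
    omega
  calc normU12 N (plateau N K) ^ 2
    _ ≤ eps N * (#(bonds N) • 1) := by
        rw [normU12_sq]
        exact mul_le_mul_of_nonneg_left hsum eps_nonneg
    _ = 2 * (eps N * N) := by
        rw [hcard, nsmul_one]
        push_cast
        ring
    _ = 2 := by rw [eps_mul_cast hN, mul_one]

theorem ip_Lqce_plateau (hN : 0 < N) (hK : 2 ≤ K) (u : Disp N) :
    ip N (Lqce N K a b u) (plateau N K) =
      (a + 4 * b) * (eps N * ∑ l ∈ bonds N, strain N u l * strain N (plateau N K) l) := by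
  rw [ip_Lqce hN hK, mul_left_comm, mul_sum (a := a + 4 * b)]
  refine congrArg _ (sum_congr rfl fun l _ => ?_)
  by_cases hl : l < -K - 1 ∨ K + 2 < l
  · rw [stress_of_far _ hl, mul_assoc]
  · rw [strain_plateau_eq_zero hN (by omega) (by omega)]
    simp only [mul_zero]

theorem abs_ip_Lqce_plateau_le (hN : 0 < N) (hK : 2 ≤ K) (u : Disp N) :
    |ip N (Lqce N K a b u) (plateau N K)| ≤ √2 * |a + 4 * b| * normU12 N u := by
  rw [ip_Lqce_plateau hN hK, abs_mul, mul_comm √2, mul_assoc, mul_comm √2]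
  exact mul_le_mul_of_nonneg_left ((abs_sum_strain_mul_strain_le _ _).trans
    (mul_le_mul_of_nonneg_left (normU12_plateau_le hN) (normU12_nonneg _))) (abs_nonneg _)

theorem ip_Lqce_sub_Lqcf_plateau (hK : 2 ≤ K) (hKN : K + 2 < N) (v : Disp N) :
    ip N ((Lqce N K a b - Lqcf N K a b) v : Disp N) (plateau N K) =
      b * ((N - K - 2) * eps N) *
        ((strain N v K - 2 * strain N v (K + 1) + strain N v (K + 2)) -
          (strain N v (1 - K) - 2 * strain N v (-K) + strain N v (-K - 1))) := by
  have hplateau {j : ℤ} (hj : j.natAbs ≤ K + 2) :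
      (plateau N K : ℤ → ℝ) j = (N - K - 2) * eps N := by
    rw [plateau_apply, max_eq_right hj, Nat.cast_sub hKN.le]
    push_cast
    ring
  rw [ip_Lqce_sub_Lqcf hK hKN]
  calc b * ∑ j ∈ interface K, _
    _ = b * ∑ j ∈ interface K, (interfaceForce K (strain N v) j +
          interfaceForce K (strain N fun i => (v : ℤ → ℝ) (-i)) j) * ((N - K - 2) * eps N) := by
        refine congrArg _ (sum_congr rfl fun j hj => ?_)
        rw [mem_Icc] at hj
        rw [hplateau (by omega), hplateau (by omega), add_mul]
    _ = _ := by
        rw [← sum_mul, sum_add_distrib, sum_interfaceForce, sum_interfaceForce]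
        simp only [strain_comp_neg]
        ring_nf

/-- The unit displacement of the single atom `K + 1`, an atom of the right interface. -/
def hat (hKN : K + 1 < N) : Disp N :=
  ⟨fun j => if j = K + 1 then 1 else 0, fun j hj => by
    rw [Int.abs_eq_natAbs] at hj
    exact if_neg (by omega)⟩

theorem hat_apply (hKN : K + 1 < N) (j : ℤ) :
    (hat hKN : ℤ → ℝ) j = if j = K + 1 then 1 else 0 :=
  rfl

theorem strain_hat (hKN : K + 1 < N) (l : ℤ) :
    strain N (hat hKN) l = N * (if l = K + 1 then 1 else if l = K + 2 then -1 else 0) := by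
  rw [strain, div_eq_mul_inv, inv_eps, mul_comm, hat_apply, hat_apply]
  congr 1
  split_ifs <;> first | omega | norm_num

theorem normU12_hat (hKN : K + 1 < N) : normU12 N (hat hKN) = √2 * √N := by
  have hinterface : ({(K : ℤ) + 1, (K : ℤ) + 2} : Finset ℤ) ⊆ bonds N := by
    intro l hl
    simp only [mem_insert, mem_singleton] at hl
    rw [mem_Icc]
    omega
  have hsum : ∑ l ∈ bonds N, strain N (hat hKN) l ^ 2 = 2 * N * N := by
    rw [← sum_subset hinterface, sum_pair (by omega), strain_hat, strain_hat, if_pos rfl,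
      if_neg (by omega), if_pos rfl]
    · ring
    · intro l _ hl
      simp only [mem_insert, mem_singleton, not_or] at hl
      rw [strain_hat, if_neg hl.1, if_neg hl.2]
      simp
  rw [← Real.sqrt_mul zero_le_two, eq_comm, Real.sqrt_eq_iff_eq_sq (by positivity)
    (normU12_nonneg _), normU12_sq, hsum]
  linear_combination (-2 * N : ℝ) * eps_mul_cast (show 0 < N by omega)

theorem ip_Lqce_sub_Lqcf_hat_plateau (hK : 2 ≤ K) (hKN : K + 2 < N) :
    ip N ((Lqce N K a b - Lqcf N K a b) (hat (Nat.lt_of_succ_lt hKN)) : Disp N) (plateau N K) =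
      -3 * b * (N - K - 2) := by
  rw [ip_Lqce_sub_Lqcf_plateau hK hKN]
  simp (disch := omega) only [strain_hat, if_true, if_neg]
  linear_combination (-3 * b * (N - K - 2)) * eps_mul_cast (show 0 < N by omega)

theorem mul_sqrt_le_opNormU12_Gqce (hK : 2 ≤ K) (hN : 8 ≤ N) (hKN : 2 * K ≤ N) {c : ℝ}
    (hc : 0 < c) (hcoer : CoerciveWith c (Lqce N K a b)) :
    3 / 8 * |b| * √N ≤ |a + 4 * b| * opNormU12 N (Gqce N K a b) := by
  have hKN' : K + 2 < N := by omega
  let v : Disp N := hat (Nat.lt_of_succ_lt hKN')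
  have hgap : (N : ℝ) / 4 ≤ N - K - 2 := by
    have hN' : (8 : ℝ) ≤ N := by exact_mod_cast hN
    have hKN'' : 2 * (K : ℝ) ≤ N := by exact_mod_cast hKN
    linarith
  have hforce : 3 / 4 * |b| * N ≤ √2 * |a + 4 * b| * normU12 N (Gqce N K a b v) := by
    refine le_trans ?_ (abs_ip_Lqce_plateau_le (by omega) hK _)
    rw [Lqce_Gqce_apply (hcoer.isUnit hc), ip_Lqce_sub_Lqcf_hat_plateau hK hKN', abs_mul, abs_mul,
      abs_of_nonneg ((by positivity : (0 : ℝ) ≤ N / 4).trans hgap), abs_neg, Nat.abs_ofNat]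
    linarith [mul_le_mul_of_nonneg_left hgap (abs_nonneg b)]
  have hop : normU12 N (Gqce N K a b v) ≤ opNormU12 N (Gqce N K a b) * (√2 * √N) := by
    rw [← normU12_hat]
    exact normU12_le_opNormU12_mul (normU12_Gqce_le hK hKN' hc hcoer) v
  have hsqrtN : 0 < √(N : ℝ) := Real.sqrt_pos.mpr (by exact_mod_cast (by omega : 0 < N))
  refine le_of_mul_le_mul_right ?_ hsqrtN
  calc 3 / 8 * |b| * √N * √N
    _ = 3 / 4 * |b| * N / 2 := by
        rw [mul_assoc, Real.mul_self_sqrt N.cast_nonneg]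
        ring
    _ ≤ √2 * |a + 4 * b| * (opNormU12 N (Gqce N K a b) * (√2 * √N)) / 2 :=
        div_le_div_of_nonneg_right
          (hforce.trans (mul_le_mul_of_nonneg_left hop (by positivity))) zero_le_two
    _ = √2 ^ 2 / 2 * (|a + 4 * b| * opNormU12 N (Gqce N K a b) * √N) := by ring
    _ = |a + 4 * b| * opNormU12 N (Gqce N K a b) * √N := by
        rw [Real.sq_sqrt zero_le_two, div_self two_ne_zero, one_mul]

theorem sqrt_le_mul_opNormU12_Gqce (hb : b ≠ 0) (hK : 2 ≤ K) (hN : 8 ≤ N) (hKN : 2 * K ≤ N) {c : ℝ}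
    (hc : 0 < c) (hcoer : CoerciveWith c (Lqce N K a b)) :
    √N ≤ 8 * |a + 4 * b| / (3 * |b|) * opNormU12 N (Gqce N K a b) := by
  have hb' : 0 < 3 * |b| := mul_pos three_pos (abs_pos.mpr hb)
  rw [div_mul_eq_mul_div, le_div_iff₀ hb']
  linarith [mul_sqrt_le_opNormU12_Gqce hK hN hKN hc hcoer]

end QC

end

theorem mainTheorem5 (a b : ℝ) (ha : 0 < a) (hb : b ≠ 0) :
    ∃ C : ℝ, 0 < C ∧ ∃ N₀ : ℕ, ∀ N : ℕ, N₀ ≤ N → ∀ K : ℕ, 2 ≤ K → 2 * K ≤ N →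
      0 < (a + 4 * b) + QC.lamK K * b →
        IsUnit (QC.Lqce N K a b) ∧
        C⁻¹ * Real.sqrt (N : ℝ) ≤ QC.opNormU12 N (QC.Gqce N K a b) ∧
        QC.opNormU12 N (QC.Gqce N K a b) ≤ C * Real.sqrt (N : ℝ) ∧
        1 < QC.opNormU12 N (QC.Gqce N K a b) := by
  obtain ⟨c, hc, hcoer⟩ := QC.exists_uniform_coercivity b ha
  let C := 16 * √2 * |b| / c + 8 * |a + 4 * b| / (3 * |b|)
  have hC : 0 < C := by positivity
  refine ⟨C, hC, max 8 (⌊C ^ 2⌋₊ + 1), fun N hN K hK hKN hpos => ?_⟩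
  obtain ⟨hN8, hNC⟩ := max_le_iff.mp hN
  have hcoerN := hcoer N K hK (by omega) hpos
  have hupper := QC.opNormU12_Gqce_le hK (by omega) hc hcoerN
  have hlower := QC.sqrt_le_mul_opNormU12_Gqce hb hK hN8 hKN hc hcoerN
  have hnonneg := QC.opNormU12_nonneg (QC.Gqce N K a b)
  have hlower' : C⁻¹ * √N ≤ QC.opNormU12 N (QC.Gqce N K a b) := by
    rw [inv_mul_le_iff₀ hC]
    exact hlower.trans (mul_le_mul_of_nonneg_right (le_add_of_nonneg_left (by positivity)) hnonneg)
  have hsqrt : C < √N := (Real.lt_sqrt hC.le).mpr ((Nat.floor_lt (sq_nonneg C)).mp hNC)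
  refine ⟨hcoerN.isUnit hc, hlower', hupper.trans ?_, lt_of_lt_of_le ?_ hlower'⟩
  · exact mul_le_mul_of_nonneg_right (le_add_of_nonneg_right (by positivity)) (Real.sqrt_nonneg _)
  · rwa [lt_inv_mul_iff₀ hC, mul_one]
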